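/- Hidden-action principal-agent problem: there are $n\ge 1$ agent actions and $m$ outcomes; outcome $j$ gives the principal a reward $r_j\in[0,1]$; action $i$ has a cost $c_i\in[0,1]$ for the agent (with $c_1=0$) and a probability distribution $F_i$ over outcomes; put $R_i=\mathbb{E}_{j\sim F_i}[r_j]$. Under the linear contract $\rho\in[0,1]$ (the principal pays the fraction $\rho$ of the realized reward) the agent plays a best response $i^\star(\rho)\in\arg\max_i(\rho R_i-c_i)$, ties being broken in favor of the principal, and the principal's expected utility is $u(\rho)=(1-\rho)R_{i^\star(\rho)}$. In the Bayesian problem there are moreover $d$ agent types; the costs $c_{i,k}$ (with $c_{1,k}=0$) and the distributions $F_{i,k}$ depend on the type $k$, type $k$ plays a best response $i^\star_k(\rho)$ (same rule), and $u(\rho)=\mathbb{E}_{k\sim\mathcal D}\big[(1-\rho)R_{i^\star_k(\rho),k}\big]$ for a fixed distribution $\mathcal D$ over types, where $R_{i,k}=\mathbb{E}_{j\sim F_{i,k}}[r_j]$. The interaction is repeated for $T\ge 1$ rounds. At round $t$ the principal commits to $\rho_t\in[0,1]$, the agent (in the Bayesian case, of a type drawn afresh from $\mathcal D$ and not observed)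 best responds, an outcome $j_t$ is drawn from the distribution of the played action, and the principal observes its reward $r_{j_t}$, but not the action. A (deterministic) algorithm knows $T$ and chooses $\rho_t$ as a function of $(\rho_s,r_{j_s})_{s<t}$; it is given neither the instance nor $n$, $m$, $d$. Its regret against the best linear contract is $$\mathcal R_T = T\cdot\sup_{\rho\in[0,1]}u(\rho)-\mathbb{E}\Big[\sum_{t=1}^T u(\rho_t)\Big].$$ 1. There are an algorithm and universal constants $C>0$, $a\in\mathbb N$ such that, for all $T\ge1$ and all hidden-action principal-agent problems, with any number $n$ of actions and $m$ of outcomes, $\mathcal R_T\le C\sqrt{nT}\,\log^a(T+1)$; that is, $\mathcal R_T=\widetilde O(\sqrt{nT})$. 2. There are an algorithm and universal constants $C>0$, $a\in\mathbb N$ such that, for all $T\ge1$ and all Bayesian hidden-action principal-agent problems, with any number $n$ of actions, $m$ of outcomes and $d$ of types, $\mathcal R_T\le C\sqrt{ndT}\,\log^a(T+1)$; that is, $\mathcal R_T=\widetilde O(\sqrt{ndT})$. -/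

import Mathlib

/-- A (non-Bayesian) hidden-action principal-agent problem with `n` agent actions and `m` outcomes.
Action `0 : Fin n` is the one written `1` in `[n]`; it is free for the agent. -/
structure PrincipalAgent (n m : ℕ) [NeZero n] where
  /-- principal's reward for each outcome -/
  reward : Fin m → ℝ
  reward_mem : ∀ j, reward j ∈ Set.Icc (0 : ℝ) 1
  /-- `outcomeProb i j` is the probability of outcome `j` under action `i` -/
  outcomeProb : Fin n → Fin m → ℝ
  outcomeProb_nonneg : ∀ i j, 0 ≤ outcomeProb i j
  outcomeProb_sum : ∀ i, ∑ j, outcomeProb i j = 1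
  /-- agent's cost of each action -/
  cost : Fin n → ℝ
  cost_mem : ∀ i, cost i ∈ Set.Icc (0 : ℝ) 1
  cost_zero : cost 0 = 0

/-- A Bayesian hidden-action principal-agent problem with `d` agent types: costs and outcome
distributions depend on the type, which is drawn from `typeProb`. -/
structure BayesianPrincipalAgent (n m d : ℕ) [NeZero n] where
  /-- principal's reward for each outcome -/
  reward : Fin m → ℝ
  reward_mem : ∀ j, reward j ∈ Set.Icc (0 : ℝ) 1
  /-- `outcomeProb k i j`: probability of outcome `j` when type `k` plays action `i` -/
  outcomeProb : Fin d → Fin n → Fin m → ℝ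
  outcomeProb_nonneg : ∀ k i j, 0 ≤ outcomeProb k i j
  outcomeProb_sum : ∀ k i, ∑ j, outcomeProb k i j = 1
  /-- `cost k i`: cost of action `i` for type `k` -/
  cost : Fin d → Fin n → ℝ
  cost_mem : ∀ k i, cost k i ∈ Set.Icc (0 : ℝ) 1
  cost_zero : ∀ k, cost k 0 = 0
  /-- distribution of the agent's type -/
  typeProb : Fin d → ℝ
  typeProb_nonneg : ∀ k, 0 ≤ typeProb k
  typeProb_sum : ∑ k, typeProb k = 1

namespace PrincipalAgent

variable {n m : ℕ} [NeZero n]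

/-- Principal's expected reward `R_i` when the agent plays action `i`. -/
def expectedReward (P : PrincipalAgent n m) (i : Fin n) : ℝ :=
  ∑ j, P.outcomeProb i j * P.reward j

/-- Agent's expected utility from action `i` under the linear contract `ρ`. -/
def agentUtility (P : PrincipalAgent n m) (ρ : unitInterval) (i : Fin n) : ℝ :=
  (ρ : ℝ) * P.expectedReward i - P.cost i

/-- Principal's expected utility under the linear contract `ρ` if the agent plays `i`. -/
def principalUtility (P : PrincipalAgent n m) (ρ : unitInterval) (i : Fin n) : ℝ :=
  (1 - (ρ : ℝ)) * P.expectedReward i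

/-- `br` maps every linear contract to a best response of the agent, with ties broken in favor of
the principal. -/
def IsBestResponse (P : PrincipalAgent n m) (br : unitInterval → Fin n) : Prop :=
  ∀ ρ : unitInterval,
    (∀ i, P.agentUtility ρ i ≤ P.agentUtility ρ (br ρ)) ∧
    ∀ i, P.agentUtility ρ i = P.agentUtility ρ (br ρ) →
      P.principalUtility ρ i ≤ P.principalUtility ρ (br ρ)

/-- Principal's expected utility `u(ρ)` when the agent best responds according to `br`. -/
def utility (P : PrincipalAgent n m) (br : unitInterval → Fin n) (ρ : unitInterval) : ℝ :=
  P.principalUtility ρ (br ρ)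

end PrincipalAgent

namespace BayesianPrincipalAgent

variable {n m d : ℕ} [NeZero n]

/-- The principal-agent problem faced when the agent is of type `k`. -/
def ofType (P : BayesianPrincipalAgent n m d) (k : Fin d) : PrincipalAgent n m where
  reward := P.reward
  reward_mem := P.reward_mem
  outcomeProb := P.outcomeProb k
  outcomeProb_nonneg := P.outcomeProb_nonneg k
  outcomeProb_sum := P.outcomeProb_sum k
  cost := P.cost k
  cost_mem := P.cost_mem k
  cost_zero := P.cost_zero k

/-- `br k` is a best-response map of the agent of type `k`, for every type `k`. -/
def IsBestResponse (P : BayesianPrincipalAgent n m d) (br : Fin d → unitInterval → Fin n) : Prop :=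
  ∀ k, (P.ofType k).IsBestResponse (br k)

/-- Principal's expected utility under the linear contract `ρ`, in expectation over the type. -/
def utility (P : BayesianPrincipalAgent n m d) (br : Fin d → unitInterval → Fin n)
    (ρ : unitInterval) : ℝ :=
  ∑ k, P.typeProb k * (P.ofType k).utility (br k) ρ

/-- Probability of outcome `j` under the linear contract `ρ`: a type `k` is drawn, an agent of that
type plays `br k ρ`, and `j` is drawn from the distribution of this action. -/
def outcomeLaw (P : BayesianPrincipalAgent n m d) (br : Fin d → unitInterval → Fin n)
    (ρ : unitInterval) (j : Fin m) : ℝ :=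
  ∑ k, P.typeProb k * P.outcomeProb k (br k ρ) j

end BayesianPrincipalAgent

/-- The history of play (oldest round first): for each past round, the linear contract that was
committed to and the reward of the outcome that was then observed. -/
abbrev History := List (unitInterval × ℝ)

/-- A deterministic policy of the principal: the contract to commit to after each history. -/
abbrev Policy := History → unitInterval

/-- Expectation of `f (H_T)`, where `H_T` is the random history of the first `T` rounds when the
principal follows `π`, the outcome of a round with contract `ρ` is drawn from `law ρ` independently
of the past, and outcome `j` gives reward `r j`. It is computed by conditioning on the history of
the rounds before the last one. -/
noncomputable def historyExpectation {m : ℕ} (r : Fin m → ℝ) (law : unitInterval → Fin m → ℝ)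
    (π : Policy) : ℕ → (History → ℝ) → ℝ
  | 0, f => f []
  | T + 1, f => historyExpectation r law π T
      (fun h => ∑ j, law (π h) j * f (h ++ [(π h, r j)]))

/-- `T * sup u - 𝔼 [∑ t, u (ρ_t)]`, for rewards `r`, outcome law `law` and one-round utility `u`. -/
noncomputable def regretOf {m : ℕ} (r : Fin m → ℝ) (law : unitInterval → Fin m → ℝ)
    (u : unitInterval → ℝ) (π : Policy) (T : ℕ) : ℝ :=
  (T : ℝ) * (⨆ ρ : unitInterval, u ρ) -
    historyExpectation r law π T (fun h => (h.map (fun o => u o.1)).sum)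

/-- Regret of `π` over `T` rounds against the best linear contract. -/
noncomputable def PrincipalAgent.regret {n m : ℕ} [NeZero n] (P : PrincipalAgent n m)
    (br : unitInterval → Fin n) (π : Policy) (T : ℕ) : ℝ :=
  regretOf P.reward (fun ρ => P.outcomeProb (br ρ)) (P.utility br) π T

/-- Regret of `π` over `T` rounds against the best linear contract, with a fresh agent type drawn
(and not observed) at every round. -/
noncomputable def BayesianPrincipalAgent.regret {n m d : ℕ} [NeZero n]
    (P : BayesianPrincipalAgent n m d) (br : Fin d → unitInterval → Fin n) (π : Policy)
    (T : ℕ) : ℝ :=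
  regretOf P.reward (P.outcomeLaw br) (P.utility br) π T

/-! Only two features of the problem matter. The mean reward `R ρ` is monotone, because a larger
share never makes a best-responding agent choose an action with smaller expected reward. It also
jumps fewer than `N` times along any monotone sequence of contracts, where `N = n`, or `N = n * d`
with types. The abstract `IsMonotoneModel` keeps the first feature, the jump bound is a separate
hypothesis, and one algorithm, which knows only `T`, serves both claims.

Monotonicity makes the utility one-sided Lipschitz: on `[a, b]` it is at most `(1 - a) * R b`, which
exceeds the utility at `b` by `(b - a) * R b`. Sampling the right endpoint of a dyadic interval
therefore gives an upper confidence bound on the whole interval. The policy zooms: it follows the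
largest such bound and refines an interval once the sampling error is small compared with width
times reward. While the estimates are accurate, a round then costs `O(radius) + 1 / 2 ^ L`
(`IsSelected.regret_le`).

The jump bound limits the refinement. If `R` takes the same positive value throughout an interval
and the one to its left, the left end of that neighbour is better by a full width, which rules out
the interval. So each scale has at most `2 * N` refined intervals
(`IsMonotoneModel.card_relevantCells_le`), and only `O(N * L)` contracts are ever played.
Cauchy-Schwarz over these contracts gives `√(N * T)` up to logarithms; inaccurate estimates are
excluded by an exponential supermartingale and a union bound. -/

/-! ### Expectations over histories -/

section HistoryExpectation

variable {m : ℕ} {r : Fin m → ℝ} {law : unitInterval → Fin m → ℝ} {π : Policy}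

theorem historyExpectation_add (T : ℕ) (f g : History → ℝ) :
    historyExpectation r law π T (fun h => f h + g h) =
      historyExpectation r law π T f + historyExpectation r law π T g := by
  induction T generalizing f g with
  | zero => rfl
  | succ T ih =>
    simp only [historyExpectation, mul_add, Finset.sum_add_distrib]
    exact ih _ _

theorem historyExpectation_const_mul (T : ℕ) (c : ℝ) (f : History → ℝ) :
    historyExpectation r law π T (fun h => c * f h) = c * historyExpectation r law π T f := by
  induction T generalizing f with
  | zero => rfl
  | succ T ih =>
    simp only [historyExpectation]
    rw [← ih]
    congr 1
    funext h
    rw [Finset.mul_sum]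
    exact Finset.sum_congr rfl fun j _ => by ring

theorem historyExpectation_sum {ι : Type*} (s : Finset ι) (T : ℕ) (f : ι → History → ℝ) :
    historyExpectation r law π T (fun h => ∑ i ∈ s, f i h) =
      ∑ i ∈ s, historyExpectation r law π T (f i) := by
  classical
  induction s using Finset.induction_on with
  | empty => simpa using historyExpectation_const_mul (r := r) (law := law) (π := π) T 0 (fun _ => 0)
  | insert i s hi ih =>
    simp only [Finset.sum_insert hi, ← ih]
    exact historyExpectation_add T _ _

theorem historyExpectation_const (hsum : ∀ ρ, ∑ j, law ρ j = 1) (T : ℕ) (c : ℝ) :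
    historyExpectation r law π T (fun _ => c) = c := by
  induction T with
  | zero => rfl
  | succ T ih => simpa only [historyExpectation, ← Finset.sum_mul, hsum, one_mul] using ih

/-- Histories of length `T` all of whose rewards lie in `[0, 1]`. -/
def IsUnitHistory (T : ℕ) (h : History) : Prop :=
  h.length = T ∧ ∀ o ∈ h, o.2 ∈ Set.Icc (0 : ℝ) 1

theorem IsUnitHistory.snoc {T : ℕ} {h : History} (hh : IsUnitHistory T h) (ρ : unitInterval)
    {x : ℝ} (hx : x ∈ Set.Icc (0 : ℝ) 1) : IsUnitHistory (T + 1) (h ++ [(ρ, x)]) := by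
  refine ⟨by simp [hh.1], fun o ho => ?_⟩
  rcases List.mem_append.1 ho with ho | ho
  · exact hh.2 o ho
  · rw [List.mem_singleton.1 ho]
    exact hx

theorem historyExpectation_mono (hlaw : ∀ ρ j, 0 ≤ law ρ j)
    (hr : ∀ j, r j ∈ Set.Icc (0 : ℝ) 1) {T : ℕ} {f g : History → ℝ}
    (hfg : ∀ h, IsUnitHistory T h → f h ≤ g h) :
    historyExpectation r law π T f ≤ historyExpectation r law π T g := by
  induction T generalizing f g with
  | zero => exact hfg [] ⟨rfl, by simp⟩
  | succ T ih =>
    exact ih fun h hh => Finset.sum_le_sum fun j _ =>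
      mul_le_mul_of_nonneg_left (hfg _ (hh.snoc _ (hr j))) (hlaw _ _)

end HistoryExpectation

/-- One-round model: `law ρ` is a distribution over outcomes with rewards in `[0, 1]` whose mean
reward `R ρ` is monotone in the contract `ρ`. -/
structure IsMonotoneModel {m : ℕ} (r : Fin m → ℝ) (law : unitInterval → Fin m → ℝ)
    (R : unitInterval → ℝ) : Prop where
  reward_mem : ∀ j, r j ∈ Set.Icc (0 : ℝ) 1
  law_nonneg : ∀ ρ j, 0 ≤ law ρ j
  law_sum : ∀ ρ, ∑ j, law ρ j = 1
  mean_eq : ∀ ρ, ∑ j, law ρ j * r j = R ρ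
  mono : Monotone R

theorem IsMonotoneModel.mean_mem {m : ℕ} {r : Fin m → ℝ} {law : unitInterval → Fin m → ℝ}
    {R : unitInterval → ℝ} (hM : IsMonotoneModel r law R) (ρ : unitInterval) :
    R ρ ∈ Set.Icc (0 : ℝ) 1 := by
  rw [← hM.mean_eq, Set.mem_Icc]
  constructor
  · exact Finset.sum_nonneg fun j _ => mul_nonneg (hM.law_nonneg _ _) (hM.reward_mem j).1
  · rw [← hM.law_sum ρ]
    exact Finset.sum_le_sum fun j _ =>
      mul_le_of_le_one_right (hM.law_nonneg _ _) (hM.reward_mem j).2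

/-! ### Statistics of a history -/

/-- Number of rounds in which the contract `b` was played. -/
noncomputable def plays (h : History) (b : unitInterval) : ℕ :=
  (h.filter (fun o => o.1 = b)).length

/-- Total reward collected with the contract `b`. -/
noncomputable def payoff (h : History) (b : unitInterval) : ℝ :=
  ((h.filter (fun o => o.1 = b)).map Prod.snd).sum

/-- Average reward collected with the contract `b`. -/
noncomputable def empMean (h : History) (b : unitInterval) : ℝ :=
  payoff h b / plays h b

/-- Confidence radius after `k` samples. -/
noncomputable def radius (K : ℝ) (k : ℕ) : ℝ := √(K / (k + 1))

theorem plays_snoc (h : History) (ρ b : unitInterval) (x : ℝ) :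
    plays (h ++ [(ρ, x)]) b = plays h b + if ρ = b then 1 else 0 := by
  by_cases hb : ρ = b <;> simp [plays, hb]

theorem payoff_snoc (h : History) (ρ b : unitInterval) (x : ℝ) :
    payoff (h ++ [(ρ, x)]) b = payoff h b + if ρ = b then x else 0 := by
  by_cases hb : ρ = b <;> simp [payoff, hb]

theorem plays_le_length (h : History) (b : unitInterval) : plays h b ≤ h.length :=
  List.length_filter_le _ _

theorem sum_plays_le_length (B : Finset unitInterval) (h : History) :
    ∑ b ∈ B, plays h b ≤ h.length := by
  induction h using List.reverseRecOn with
  | nil => simp [plays]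
  | append_singleton h o ih =>
    obtain ⟨ρ, x⟩ := o
    simp only [plays_snoc, Finset.sum_add_distrib, Finset.sum_ite_eq, List.length_append,
      List.length_singleton]
    split_ifs <;> omega

theorem payoff_mem {T : ℕ} {h : History} (hh : IsUnitHistory T h) (b : unitInterval) :
    payoff h b ∈ Set.Icc (0 : ℝ) (plays h b) := by
  have key : ∀ l : History, (∀ o ∈ l, o.2 ∈ Set.Icc (0 : ℝ) 1) →
      (l.map Prod.snd).sum ∈ Set.Icc (0 : ℝ) l.length := by
    intro l hl
    induction l with
    | nil => simp
    | cons o l ih =>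
      have h1 := ih fun o ho => hl o (List.mem_cons_of_mem _ ho)
      have h2 := hl o List.mem_cons_self
      simp only [Set.mem_Icc, List.map_cons, List.sum_cons, List.length_cons, Nat.cast_add,
        Nat.cast_one] at h1 h2 ⊢
      constructor <;> linarith [h1.1, h1.2, h2.1, h2.2]
  exact key _ fun o ho => hh.2 o (List.mem_of_mem_filter ho)

theorem radius_pos {K : ℝ} (hK : 0 < K) (k : ℕ) : 0 < radius K k := by
  unfold radius
  positivity

/-- Makes the sum of the radii over successive plays of a contract telescope. -/
theorem radius_le_sqrt_sub_sqrt {K : ℝ} (hK : 0 ≤ K) (k : ℕ) :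
    radius K k ≤ 2 * √K * (√((k + 1 : ℕ) : ℝ) - √(k : ℝ)) := by
  have h1 : (0 : ℝ) < √((k + 1 : ℕ) : ℝ) := Real.sqrt_pos.2 (by positivity)
  have h2 : √(k : ℝ) ≤ √((k + 1 : ℕ) : ℝ) := Real.sqrt_le_sqrt (by push_cast; linarith)
  have h3 : √((k + 1 : ℕ) : ℝ) ^ 2 = k + 1 := by
    rw [Real.sq_sqrt (by positivity)]
    push_cast
    rfl
  have h4 : √(k : ℝ) ^ 2 = k := Real.sq_sqrt (by positivity)
  have h5 : radius K k = √K / √((k + 1 : ℕ) : ℝ) := by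
    rw [radius, Real.sqrt_div hK]
    push_cast
    rfl
  rw [h5, div_le_iff₀ h1]
  have h6 : 1 ≤ 2 * (√((k + 1 : ℕ) : ℝ) - √(k : ℝ)) * √((k + 1 : ℕ) : ℝ) := by
    nlinarith [Real.sqrt_nonneg (k : ℝ)]
  nlinarith [Real.sqrt_nonneg K]

/-! ### Concentration of the empirical means -/

section Concentration

variable {m : ℕ} {r : Fin m → ℝ} {law : unitInterval → Fin m → ℝ} {R : unitInterval → ℝ}

/-- From `exp x ≤ 1 + x + x ^ 2` for `|x| ≤ 1`: the linear term has mean zero, and what remains is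
`(1 + c ^ 2) * exp (-c ^ 2) ≤ 1`. -/
theorem IsMonotoneModel.sum_law_mul_exp_le (hM : IsMonotoneModel r law R) (ρ : unitInterval)
    {c : ℝ} (hc : |c| ≤ 1) :
    ∑ j, law ρ j * Real.exp (c * (r j - R ρ) - c ^ 2) ≤ 1 := by
  have hR := hM.mean_mem ρ
  have key : ∀ j, law ρ j * Real.exp (c * (r j - R ρ) - c ^ 2) ≤
      law ρ j * ((1 + c ^ 2 + c * (r j - R ρ)) * Real.exp (-c ^ 2)) := by
    intro j
    have hr := hM.reward_mem j
    have h1 : |r j - R ρ| ≤ 1 := abs_le.2 ⟨by linarith [hr.1, hR.2], by linarith [hr.2, hR.1]⟩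
    have h2 : |c * (r j - R ρ)| ≤ 1 := by
      rw [abs_mul]
      exact mul_le_one₀ hc (abs_nonneg _) h1
    have h3 := (abs_le.1 (Real.abs_exp_sub_one_sub_id_le h2)).2
    have h4 : (c * (r j - R ρ)) ^ 2 ≤ c ^ 2 := by
      rw [mul_pow]
      exact mul_le_of_le_one_right (sq_nonneg c) (by rw [← sq_abs]; exact pow_le_one₀ (abs_nonneg _) h1)
    refine mul_le_mul_of_nonneg_left ?_ (hM.law_nonneg _ _)
    rw [sub_eq_add_neg, Real.exp_add]
    exact mul_le_mul_of_nonneg_right (by linarith) (Real.exp_pos _).le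
  refine (Finset.sum_le_sum fun j _ => key j).trans ?_
  have h5 : ∑ j, law ρ j * ((1 + c ^ 2 + c * (r j - R ρ)) * Real.exp (-c ^ 2)) =
      (1 + c ^ 2) * Real.exp (-c ^ 2) := by
    calc _ = ∑ j, ((1 + c ^ 2 - c * R ρ) * Real.exp (-c ^ 2) * law ρ j +
          c * Real.exp (-c ^ 2) * (law ρ j * r j)) := Finset.sum_congr rfl fun j _ => by ring
      _ = _ := by
        rw [Finset.sum_add_distrib, ← Finset.mul_sum, ← Finset.mul_sum, hM.law_sum, hM.mean_eq]
        ring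
  rw [h5, Real.exp_neg, ← div_eq_mul_inv, div_le_one (Real.exp_pos _)]
  linarith [Real.add_one_le_exp (c ^ 2)]

/-- The exponential supermartingale of the deviations at the contract `b`. -/
noncomputable def expDeviation (R : unitInterval → ℝ) (b : unitInterval) (c : ℝ) (h : History) :
    ℝ :=
  Real.exp (c * (payoff h b - plays h b * R b) - c ^ 2 * plays h b)

theorem IsMonotoneModel.historyExpectation_expDeviation_le (hM : IsMonotoneModel r law R)
    (π : Policy) (b : unitInterval) {c : ℝ} (hc : |c| ≤ 1) (T : ℕ) :
    historyExpectation r law π T (expDeviation R b c) ≤ 1 := by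
  induction T with
  | zero => simp [historyExpectation, expDeviation, payoff, plays]
  | succ T ih =>
    rw [historyExpectation]
    refine le_trans (historyExpectation_mono hM.law_nonneg hM.reward_mem fun h _ => ?_) ih
    by_cases hb : π h = b
    · have key : ∀ j, expDeviation R b c (h ++ [(π h, r j)]) =
          expDeviation R b c h * Real.exp (c * (r j - R b) - c ^ 2) := by
        intro j
        simp only [expDeviation, payoff_snoc, plays_snoc, hb, if_true, ← Real.exp_add]
        push_cast
        congr 1
        ring
      calc _ = expDeviation R b c h * ∑ j, law b j * Real.exp (c * (r j - R b) - c ^ 2) := by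
            rw [Finset.mul_sum]
            exact Finset.sum_congr rfl fun j _ => by rw [key, hb]; ring
        _ ≤ _ := mul_le_of_le_one_right (Real.exp_pos _).le (hM.sum_law_mul_exp_le b hc)
    · simp only [expDeviation, payoff_snoc, plays_snoc, hb, if_false, add_zero, ← Finset.sum_mul,
        hM.law_sum, one_mul, le_refl]

/-- Every empirical mean at a contract of `G` is within its confidence radius. -/
def IsAccurate (R : unitInterval → ℝ) (K : ℝ) (G : Finset unitInterval) (h : History) : Prop :=
  ∀ b ∈ G, |empMean h b - R b| ≤ radius K (plays h b)

-- A pointwise Chernoff bound. The number of plays is random, so the exponent cannot be tuned to it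
-- in advance; instead the sum runs over all possible counts `k`, each with its own exponent `±
-- radius K k / 2`.
open Classical in
theorem IsMonotoneModel.inaccurate_le (hM : IsMonotoneModel r law R) {K : ℝ} (hK : 1 ≤ K)
    (G : Finset unitInterval) {t T : ℕ} (htT : t ≤ T) {h : History} (hh : IsUnitHistory t h) :
    (if IsAccurate R K G h then (0 : ℝ) else 1) ≤
      ∑ b ∈ G, ∑ k ∈ (Finset.range (T + 1)).filter (fun k => k ≠ 0 ∧ radius K k ≤ 1),
        Real.exp (-(K / 8)) *
          (expDeviation R b (radius K k / 2) h + expDeviation R b (-(radius K k / 2)) h) := by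
  have hnn : ∀ b k, 0 ≤ Real.exp (-(K / 8)) *
          (expDeviation R b (radius K k / 2) h + expDeviation R b (-(radius K k / 2)) h) :=
    fun b k => mul_nonneg (Real.exp_pos _).le (add_nonneg (Real.exp_pos _).le (Real.exp_pos _).le)
  split_ifs with hacc
  · exact Finset.sum_nonneg fun b _ => Finset.sum_nonneg fun k _ => hnn b k
  simp only [IsAccurate, not_forall, not_le] at hacc
  obtain ⟨b, hb, hdev⟩ := hacc
  have hpay := payoff_mem hh b
  have hR := hM.mean_mem b
  -- An unplayed contract is never inaccurate: its empirical mean is `0 / 0 = 0`, and its radius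
  -- `√K` is at least `1`.
  have hn0 : plays h b ≠ 0 := by
    intro h0
    rw [empMean, h0, Nat.cast_zero, div_zero, zero_sub, abs_neg, abs_of_nonneg hR.1, radius] at hdev
    have : 1 ≤ √(K / ((0 : ℕ) + 1)) := Real.one_le_sqrt.2 (by simpa using hK)
    linarith [hR.2]
  have hnpos : (0 : ℝ) < plays h b := by exact_mod_cast Nat.pos_of_ne_zero hn0
  have hmean : empMean h b ∈ Set.Icc (0 : ℝ) 1 :=
    ⟨div_nonneg hpay.1 hnpos.le, (div_le_one hnpos).2 hpay.2⟩
  have hrad : radius K (plays h b) ≤ 1 :=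
    hdev.le.trans (abs_le.2 ⟨by linarith [hmean.1, hR.2], by linarith [hmean.2, hR.1]⟩)
  have hmem : plays h b ∈ (Finset.range (T + 1)).filter (fun k => k ≠ 0 ∧ radius K k ≤ 1) := by
    simp only [Finset.mem_filter, Finset.mem_range]
    have := plays_le_length h b
    have := hh.1
    exact ⟨by omega, hn0, hrad⟩
  refine le_trans ?_ (Finset.single_le_sum (fun b _ => Finset.sum_nonneg fun k _ => hnn b k) hb)
  refine le_trans ?_ (Finset.single_le_sum (fun k _ => hnn b k) hmem)
  set n := plays h b with hn
  set c := radius K n with hc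
  have hcpos : 0 < c := radius_pos (by linarith) n
  -- With exponent `c / 2` and deviation at least `c`, the log of `expDeviation` is at least `n * c
  -- ^ 2 / 2 - n * c ^ 2 / 4`. This is `K / 4 * (n / (n + 1)) ≥ K / 8` since `n ≥ 1`.
  have hsq : K / 8 ≤ n * c ^ 2 / 4 := by
    have h1 : (1 : ℝ) ≤ n := by exact_mod_cast Nat.one_le_iff_ne_zero.2 hn0
    rw [hc, radius, Real.sq_sqrt (by positivity), ← mul_div_assoc, div_div, le_div_iff₀ (by positivity)]
    nlinarith
  have hmul : empMean h b * n = payoff h b := div_mul_cancel₀ _ hnpos.ne'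
  have hexp : ∀ s : ℝ, n * c ≤ s * (payoff h b - n * R b) → s ^ 2 = 1 →
      1 ≤ Real.exp (-(K / 8)) * expDeviation R b (s * (c / 2)) h := by
    intro s hs hs2
    rw [expDeviation, ← Real.exp_add, ← hn]
    refine Real.one_le_exp ?_
    have : (s * (c / 2)) ^ 2 = c ^ 2 / 4 := by rw [mul_pow, hs2]; ring
    rw [this]
    nlinarith
  have hp1 := (Real.exp_pos (-(K / 8))).le
  have hp2 : 0 ≤ expDeviation R b (c / 2) h := (Real.exp_pos _).le
  have hp3 : 0 ≤ expDeviation R b (-(c / 2)) h := (Real.exp_pos _).le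
  rcases lt_abs.1 hdev with hd | hd
  · have := hexp 1 (by nlinarith) (by norm_num)
    rw [one_mul] at this
    nlinarith [mul_nonneg hp1 hp3]
  · have := hexp (-1) (by nlinarith) (by norm_num)
    rw [neg_one_mul] at this
    nlinarith [mul_nonneg hp1 hp2]

open Classical in
theorem IsMonotoneModel.historyExpectation_inaccurate_le (hM : IsMonotoneModel r law R)
    (π : Policy) {K : ℝ} (hK : 1 ≤ K) (G : Finset unitInterval) {t T : ℕ} (htT : t ≤ T) :
    historyExpectation r law π t (fun h => if IsAccurate R K G h then (0 : ℝ) else 1) ≤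
      G.card * T * (2 * Real.exp (-(K / 8))) := by
  refine (historyExpectation_mono hM.law_nonneg hM.reward_mem
    fun h hh => hM.inaccurate_le hK G htT hh).trans ?_
  simp only [historyExpectation_sum, historyExpectation_const_mul, historyExpectation_add]
  set S := (Finset.range (T + 1)).filter (fun k => k ≠ 0 ∧ radius K k ≤ 1) with hS
  have hcard : S.card ≤ T := by
    calc S.card ≤ ((Finset.range (T + 1)).erase 0).card := Finset.card_le_card fun k hk => by
          simp only [hS, Finset.mem_filter] at hk
          exact Finset.mem_erase.2 ⟨hk.2.1, hk.1⟩
      _ = T := by simp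
  have hterm : ∀ b, ∀ k ∈ S, Real.exp (-(K / 8)) *
      (historyExpectation r law π t (expDeviation R b (radius K k / 2)) +
        historyExpectation r law π t (expDeviation R b (-(radius K k / 2)))) ≤
      2 * Real.exp (-(K / 8)) := by
    intro b k hk
    have h1 := (Finset.mem_filter.1 hk).2.2
    have h0 := (radius_pos (by linarith : 0 < K) k).le
    have h2 : |radius K k / 2| ≤ 1 := by rw [abs_of_nonneg (by linarith)]; linarith
    have h3 := hM.historyExpectation_expDeviation_le π b h2 t
    have h4 := hM.historyExpectation_expDeviation_le π b ((abs_neg _).trans_le h2) t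
    nlinarith [Real.exp_pos (-(K / 8))]
  calc _ ≤ ∑ _b ∈ G, ∑ _k ∈ S, 2 * Real.exp (-(K / 8)) :=
        Finset.sum_le_sum fun b _ => Finset.sum_le_sum fun k hk => hterm b k hk
    _ = G.card * (S.card * (2 * Real.exp (-(K / 8)))) := by simp
    _ ≤ _ := by
        rw [mul_assoc]
        have : (S.card : ℝ) ≤ T := by exact_mod_cast hcard
        gcongr

end Concentration

/-! ### The zooming policy -/

/-- The contract `i / M`, truncated to `[0, 1]`. -/
noncomputable def gridPoint (M i : ℕ) : unitInterval :=
  ⟨min 1 ((i : ℝ) / M), le_min zero_le_one (by positivity), min_le_left _ _⟩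

theorem gridPoint_mono (M : ℕ) : Monotone (gridPoint M) := by
  intro i j hij
  refine Subtype.coe_le_coe.1 (min_le_min_left _ ?_)
  gcongr

theorem coe_gridPoint {M i : ℕ} (hM : M ≠ 0) (hi : i ≤ M) : (gridPoint M i : ℝ) = i / M := by
  have : (0 : ℝ) < M := by exact_mod_cast Nat.pos_of_ne_zero hM
  exact min_eq_right ((div_le_one this).2 (by exact_mod_cast hi))

/-- Left endpoint of the `q`-th dyadic interval of length `2 ^ e / 2 ^ L`. -/
noncomputable def cellLeft (L e q : ℕ) : unitInterval := gridPoint (2 ^ L) (q * 2 ^ e)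

/-- Right endpoint of the `q`-th dyadic interval of length `2 ^ e / 2 ^ L`. -/
noncomputable def cellRight (L e q : ℕ) : unitInterval := gridPoint (2 ^ L) ((q + 1) * 2 ^ e)

/-- Length of the dyadic intervals of height `e`. -/
noncomputable def cellWidth (L e : ℕ) : ℝ := 2 ^ e / 2 ^ L

/-- Optimistic estimate of the principal's utility in a dyadic interval: the payment is estimated
at its left endpoint, the reward at its right endpoint. -/
noncomputable def cellIndex (L : ℕ) (K : ℝ) (h : History) (e q : ℕ) : ℝ :=
  (1 - (cellLeft L e q : ℝ)) *
    (empMean h (cellRight L e q) + radius K (plays h (cellRight L e q)))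

/-- The reward at the right endpoint of the dyadic interval is known well enough for the interval
to be subdivided. -/
def IsExpanded (L : ℕ) (K : ℝ) (h : History) (e q : ℕ) : Prop :=
  5 * radius K (plays h (cellRight L e q)) ≤ cellWidth L e * empMean h (cellRight L e q)

/-- Optimistic estimate in the `x`-th finest dyadic interval, from all dyadic intervals that
contain it. -/
noncomputable def optimisticValue (L : ℕ) (K : ℝ) (h : History) (x : ℕ) : ℝ :=
  (Finset.range (L + 1)).inf' Finset.nonempty_range_add_one fun e => cellIndex L K h e (x / 2 ^ e)

/-- `x` has the largest optimistic estimate, and `e` is the height of a dyadic interval around it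
that is not expanded while its parent is. -/
structure IsSelected (L : ℕ) (K : ℝ) (h : History) (x e : ℕ) : Prop where
  lt : x < 2 ^ L
  height_le : e ≤ L
  isMax : ∀ y < 2 ^ L, optimisticValue L K h y ≤ optimisticValue L K h x
  parent : e < L → IsExpanded L K h (e + 1) (x / 2 ^ (e + 1))
  self : e ≠ 0 → ¬ IsExpanded L K h e (x / 2 ^ e)

/-- Descend from the root through the intervals around a maximizer `x`, stopping at the first one
that is not expanded, or at height `0`. -/
theorem exists_isSelected (L : ℕ) (K : ℝ) (h : History) :
    ∃ p : ℕ × ℕ, IsSelected L K h p.1 p.2 := by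
  obtain ⟨x, hx, hmax⟩ := (Finset.range (2 ^ L)).exists_max_image (optimisticValue L K h)
    ⟨0, by simp⟩
  have key : ∀ k ≤ L, (∃ e, e ≤ L ∧ (e < L → IsExpanded L K h (e + 1) (x / 2 ^ (e + 1))) ∧
      (e ≠ 0 → ¬ IsExpanded L K h e (x / 2 ^ e))) ∨
      (L - k < L → IsExpanded L K h (L - k + 1) (x / 2 ^ (L - k + 1))) := by
    intro k
    induction k with
    | zero => exact fun _ => Or.inr fun hlt => absurd hlt (by simp)
    | succ k ih =>
      intro hk
      rcases ih (by omega) with h1 | h1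
      · exact Or.inl h1
      · by_cases h2 : IsExpanded L K h (L - k) (x / 2 ^ (L - k))
        · right
          intro _
          rwa [show L - (k + 1) + 1 = L - k by omega]
        · exact Or.inl ⟨L - k, by omega, h1, fun _ => h2⟩
  have hfin : ∃ e, e ≤ L ∧ (e < L → IsExpanded L K h (e + 1) (x / 2 ^ (e + 1))) ∧
      (e ≠ 0 → ¬ IsExpanded L K h e (x / 2 ^ e)) := by
    rcases key L le_rfl with h1 | h1
    · exact h1
    · rw [Nat.sub_self] at h1
      exact ⟨0, by omega, h1, fun h0 => absurd rfl h0⟩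
  obtain ⟨e, h1, h2, h3⟩ := hfin
  exact ⟨(x, e), Finset.mem_range.1 hx, h1, fun y hy => hmax y (Finset.mem_range.2 hy), h2, h3⟩

/-- The policy that plays the right endpoint of a selected dyadic interval. -/
noncomputable def zoomingPolicy (L : ℕ) (K : ℝ) : Policy := fun h =>
  let p := (exists_isSelected L K h).choose
  cellRight L p.2 (p.1 / 2 ^ p.2)

/-! ### Geometry of the dyadic intervals -/

theorem succ_div_mul_le {L e x : ℕ} (hx : x < 2 ^ L) (he : e ≤ L) :
    (x / 2 ^ e + 1) * 2 ^ e ≤ 2 ^ L := by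
  have h1 : x / 2 ^ e < 2 ^ (L - e) := by
    rw [Nat.div_lt_iff_lt_mul (by positivity), ← pow_add, Nat.sub_add_cancel he]
    exact hx
  calc (x / 2 ^ e + 1) * 2 ^ e ≤ 2 ^ (L - e) * 2 ^ e := Nat.mul_le_mul_right _ h1
    _ = 2 ^ L := by rw [← pow_add, Nat.sub_add_cancel he]

theorem coe_cellLeft {L e q : ℕ} (hq : (q + 1) * 2 ^ e ≤ 2 ^ L) :
    (cellLeft L e q : ℝ) = q * cellWidth L e := by
  rw [cellLeft, coe_gridPoint (by positivity) (le_trans (by gcongr; omega) hq), cellWidth]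
  push_cast
  ring

theorem coe_cellRight {L e q : ℕ} (hq : (q + 1) * 2 ^ e ≤ 2 ^ L) :
    (cellRight L e q : ℝ) = q * cellWidth L e + cellWidth L e := by
  rw [cellRight, coe_gridPoint (by positivity) hq, cellWidth]
  push_cast
  ring

theorem cellWidth_pos (L e : ℕ) : 0 < cellWidth L e := by
  unfold cellWidth
  positivity

theorem exists_mem_cells (L : ℕ) (ρ : unitInterval) :
    ∃ x < 2 ^ L, ∀ e ≤ L, cellLeft L e (x / 2 ^ e) ≤ ρ ∧ ρ ≤ cellRight L e (x / 2 ^ e) := by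
  have hpos : (0 : ℝ) < 2 ^ L := by positivity
  obtain ⟨x, hx, hle, hge⟩ : ∃ x : ℕ, x < 2 ^ L ∧ (x : ℝ) ≤ ρ * 2 ^ L ∧
      (ρ : ℝ) * 2 ^ L ≤ x + 1 := by
    -- At `ρ = 1` the floor would be `2 ^ L`, one past the last interval.
    rcases ρ.2.2.eq_or_lt with h1 | h1
    · have hp : 1 ≤ 2 ^ L := Nat.one_le_two_pow
      refine ⟨2 ^ L - 1, Nat.sub_lt hp one_pos, ?_, ?_⟩ <;> rw [h1, Nat.cast_sub hp] <;>
        push_cast <;> linarith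
    · have h0 : 0 ≤ (ρ : ℝ) * 2 ^ L := mul_nonneg ρ.2.1 hpos.le
      refine ⟨⌊(ρ : ℝ) * 2 ^ L⌋₊, ?_, Nat.floor_le h0, (Nat.lt_floor_add_one _).le⟩
      rw [Nat.floor_lt h0]
      push_cast
      nlinarith
  refine ⟨x, hx, fun e he => ?_⟩
  have hcell := succ_div_mul_le hx he
  have h1 : x / 2 ^ e * 2 ^ e ≤ x := Nat.div_mul_le_self _ _
  have h2 : x + 1 ≤ (x / 2 ^ e + 1) * 2 ^ e :=
    (Nat.lt_div_mul_add (a := x) (b := 2 ^ e) (by positivity)).trans_eq (by ring)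
  have h1' : ((x / 2 ^ e : ℕ) : ℝ) * 2 ^ e ≤ x := by exact_mod_cast h1
  have h2' : (x : ℝ) + 1 ≤ (((x / 2 ^ e : ℕ) : ℝ) + 1) * 2 ^ e := by exact_mod_cast h2
  rw [← Subtype.coe_le_coe, ← Subtype.coe_le_coe, coe_cellLeft hcell, coe_cellRight hcell,
    cellWidth, ← mul_div_assoc, ← add_div, div_le_iff₀ hpos, le_div_iff₀ hpos]
  constructor <;> linarith

/-! ### Regret of a round, and the contracts that are played -/

/-- The principal's utility under a linear contract with mean reward `R`. -/
def linearUtility (R : unitInterval → ℝ) (ρ : unitInterval) : ℝ := (1 - (ρ : ℝ)) * R ρ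

/-- All right endpoints of dyadic intervals. -/
noncomputable def dyadicGrid (L : ℕ) : Finset unitInterval :=
  (Finset.range (2 ^ L + 1)).image (gridPoint (2 ^ L))

theorem card_dyadicGrid_le (L : ℕ) : (dyadicGrid L).card ≤ 2 ^ L + 1 :=
  Finset.card_image_le.trans_eq (Finset.card_range _)

theorem cellRight_mem_dyadicGrid {L e q : ℕ} (hq : (q + 1) * 2 ^ e ≤ 2 ^ L) :
    cellRight L e q ∈ dyadicGrid L :=
  Finset.mem_image_of_mem _ (Finset.mem_range.2 (by omega))

open Classical in
/-- The dyadic intervals of height `e` that may have to be expanded. -/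
noncomputable def relevantCells (R : unitInterval → ℝ) (L e : ℕ) : Finset ℕ :=
  (Finset.range (2 ^ L)).filter fun q => (q + 1) * 2 ^ e ≤ 2 ^ L ∧ 0 < R (cellRight L e q) ∧
    (⨆ ρ, linearUtility R ρ) ≤
      (1 - (cellLeft L e q : ℝ)) * ((1 + cellWidth L e / 2) * R (cellRight L e q))

/-- The contracts that may be played while the estimates are accurate. -/
noncomputable def relevantContracts (R : unitInterval → ℝ) (L : ℕ) : Finset unitInterval :=
  insert (cellRight L L 0) ((Finset.range L).biUnion fun e =>
    (relevantCells R L (e + 1)).image (fun q => cellRight L e (2 * q)) ∪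
      (relevantCells R L (e + 1)).image (fun q => cellRight L e (2 * q + 1)))

section Round

variable {m : ℕ} {r : Fin m → ℝ} {law : unitInterval → Fin m → ℝ} {R : unitInterval → ℝ}

theorem IsMonotoneModel.linearUtility_mem (hM : IsMonotoneModel r law R) (ρ : unitInterval) :
    linearUtility R ρ ∈ Set.Icc (0 : ℝ) 1 := by
  have h1 := hM.mean_mem ρ
  have h2 := ρ.2
  exact ⟨mul_nonneg (by linarith [h2.2]) h1.1, mul_le_one₀ (by linarith [h2.1]) h1.1 h1.2⟩

theorem IsMonotoneModel.le_iSup (hM : IsMonotoneModel r law R) (ρ : unitInterval) :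
    linearUtility R ρ ≤ ⨆ ρ, linearUtility R ρ :=
  le_ciSup (f := linearUtility R) ⟨1, by rintro _ ⟨ρ, rfl⟩; exact (hM.linearUtility_mem ρ).2⟩ ρ

theorem IsMonotoneModel.iSup_le_one (hM : IsMonotoneModel r law R) :
    (⨆ ρ, linearUtility R ρ) ≤ 1 :=
  ciSup_le fun ρ => (hM.linearUtility_mem ρ).2

/-- Accuracy makes every index an upper bound for the utility on its interval. As `optimisticValue`
is a minimum over heights, maximality of `x` passes to every interval around `x`; below this is used
for the selected interval and for its parent. -/
theorem IsSelected.iSup_le_cellIndex (hM : IsMonotoneModel r law R) {L x e : ℕ} {K : ℝ}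
    {h : History} (hacc : IsAccurate R K (dyadicGrid L) h) (hs : IsSelected L K h x e) {e' : ℕ}
    (he' : e' ≤ L) : (⨆ ρ, linearUtility R ρ) ≤ cellIndex L K h e' (x / 2 ^ e') := by
  refine ciSup_le fun ρ => ?_
  obtain ⟨y, hy, hcells⟩ := exists_mem_cells L ρ
  have h1 : linearUtility R ρ ≤ optimisticValue L K h y := by
    refine Finset.le_inf' _ _ fun e he => ?_
    have heL : e ≤ L := by simpa [Nat.lt_succ_iff] using he
    obtain ⟨ha, hb⟩ := hcells e heL
    have hdev := (abs_le.1 (hacc _ (cellRight_mem_dyadicGrid (succ_div_mul_le hy heL)))).1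
    have hR := hM.mono hb
    have ha' : (cellLeft L e (y / 2 ^ e) : ℝ) ≤ ρ := ha
    have h0 := (hM.mean_mem ρ).1
    exact mul_le_mul (by linarith) (by linarith) h0 (by linarith [ρ.2.2])
  refine (h1.trans (hs.isMax y hy)).trans (Finset.inf'_le _ (Finset.mem_range.2 (by omega)))

/-- Optimism costs width times reward plus two radii. An interval that is not expanded has width
times reward at most six radii (five, and one for the estimation error); at the finest height the
width itself is `1 / 2 ^ L`. -/
theorem IsSelected.regret_le (hM : IsMonotoneModel r law R) {L x e : ℕ} {K : ℝ} (hK : 0 < K)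
    {h : History} (hacc : IsAccurate R K (dyadicGrid L) h) (hs : IsSelected L K h x e) :
    (⨆ ρ, linearUtility R ρ) - linearUtility R (cellRight L e (x / 2 ^ e)) ≤
      8 * radius K (plays h (cellRight L e (x / 2 ^ e))) + 1 / 2 ^ L := by
  have hcell := succ_div_mul_le hs.lt hs.height_le
  have hidx := hs.iSup_le_cellIndex hM hacc hs.height_le
  have hleft := coe_cellLeft hcell
  have hright := coe_cellRight hcell
  have hself := hs.self
  have hdev := abs_le.1 (hacc _ (cellRight_mem_dyadicGrid hcell))
  rw [cellIndex] at hidx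
  rw [IsExpanded] at hself
  rw [linearUtility]
  set b := cellRight L e (x / 2 ^ e)
  set a := cellLeft L e (x / 2 ^ e)
  have hrad := radius_pos hK (plays h b)
  have hR := hM.mean_mem b
  have ha0 : (0 : ℝ) ≤ a := a.2.1
  have ha1 : (a : ℝ) ≤ 1 := a.2.2
  have hb1 : (b : ℝ) ≤ 1 := b.2.2
  have hbase : (⨆ ρ, linearUtility R ρ) - (1 - (b : ℝ)) * R b ≤
      cellWidth L e * R b + 2 * radius K (plays h b) := by
    rw [hleft] at hidx ha0 ha1
    rw [hright]
    nlinarith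
  refine hbase.trans ?_
  have hw1 : cellWidth L e ≤ 1 := by linarith
  have hw0 := cellWidth_pos L e
  have hpos : (0 : ℝ) < 1 / 2 ^ L := by positivity
  by_cases he : e = 0
  · have : cellWidth L e = 1 / 2 ^ L := by simp [cellWidth, he]
    rw [this] at hw0 ⊢
    nlinarith [hR.2]
  · have h1 := not_le.1 (hself he)
    nlinarith

/-- A selected interval is the root or a child of an expanded interval, so it suffices that the
parent is relevant. -/
theorem IsSelected.mem_relevantContracts (hM : IsMonotoneModel r law R) {L x e : ℕ} {K : ℝ}
    (hK : 0 < K) {h : History} (hacc : IsAccurate R K (dyadicGrid L) h)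
    (hs : IsSelected L K h x e) : cellRight L e (x / 2 ^ e) ∈ relevantContracts R L := by
  rcases hs.height_le.eq_or_lt with rfl | heL
  · rw [Nat.div_eq_of_lt hs.lt]
    exact Finset.mem_insert_self _ _
  have hmem : x / 2 ^ (e + 1) ∈ relevantCells R L (e + 1) := by
    have hcell := succ_div_mul_le hs.lt (Nat.succ_le_of_lt heL)
    have hidx := hs.iSup_le_cellIndex hM hacc (Nat.succ_le_of_lt heL)
    have hexp := hs.parent heL
    have hdev := abs_le.1 (hacc _ (cellRight_mem_dyadicGrid hcell))
    have hright := coe_cellRight hcell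
    have ha1 : (cellLeft L (e + 1) (x / 2 ^ (e + 1)) : ℝ) ≤ 1 :=
      unitInterval.le_one _
    have hw0 := cellWidth_pos L (e + 1)
    have hw1 : cellWidth L (e + 1) ≤ 1 := by
      have h1 : (cellRight L (e + 1) (x / 2 ^ (e + 1)) : ℝ) ≤ 1 :=
      unitInterval.le_one _
      have h2 : (0 : ℝ) ≤ (x / 2 ^ (e + 1) : ℕ) * cellWidth L (e + 1) := by positivity
      linarith
    have hrad := radius_pos hK (plays h (cellRight L (e + 1) (x / 2 ^ (e + 1))))
    rw [IsExpanded] at hexp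
    -- One of the five radii pays for replacing the empirical mean by `R`. The remaining four turn
    -- the optimistic excess of two radii into the factor `1 + cellWidth / 2`.
    have h4 : 4 * radius K (plays h (cellRight L (e + 1) (x / 2 ^ (e + 1)))) ≤
        cellWidth L (e + 1) * R (cellRight L (e + 1) (x / 2 ^ (e + 1))) := by nlinarith
    refine Finset.mem_filter.2 ⟨Finset.mem_range.2 ((Nat.div_le_self _ _).trans_lt hs.lt), hcell,
      ?_, hidx.trans (mul_le_mul_of_nonneg_left (by linarith) (by linarith))⟩
    exact pos_of_mul_pos_right (by linarith) hw0.le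
  refine Finset.mem_insert_of_mem (Finset.mem_biUnion.2 ⟨e, Finset.mem_range.2 heL, ?_⟩)
  have hdiv : x / 2 ^ (e + 1) = x / 2 ^ e / 2 := by rw [pow_succ, Nat.div_div_eq_div_mul]
  rw [hdiv] at hmem
  rcases Nat.even_or_odd' (x / 2 ^ e) with ⟨q, hq | hq⟩
  · refine Finset.mem_union_left _ (Finset.mem_image.2 ⟨_, hmem, ?_⟩)
    congr 1
    omega
  · refine Finset.mem_union_right _ (Finset.mem_image.2 ⟨_, hmem, ?_⟩)
    congr 1
    omega

/-! ### Counting the relevant intervals by the jumps of `R` -/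

open Classical in
/-- The steps at which `R` jumps, among the first `Q` steps of the sequence `f`. -/
noncomputable def jumpCells (R : unitInterval → ℝ) (f : ℕ → unitInterval) (Q : ℕ) : Finset ℕ :=
  (Finset.range Q).filter fun q => R (f q) ≠ R (f (q + 1))

/-- Apart from `q = 0`, a relevant interval has a jump of `R` across itself or across its left
neighbour, so there are at most `2 * (N - 1) + 1`. -/
theorem IsMonotoneModel.card_relevantCells_le (hM : IsMonotoneModel r law R) {N : ℕ}
    (hN : ∀ f : ℕ → unitInterval, Monotone f → ∀ Q, (jumpCells R f Q).card + 1 ≤ N) (L e : ℕ) :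
    (relevantCells R L e).card ≤ 2 * N := by
  classical
  set f : ℕ → unitInterval := fun q => cellLeft L e q with hf
  have hmono : Monotone f := fun p q hpq => gridPoint_mono _ (by gcongr)
  have hsub : relevantCells R L e ⊆
      insert 0 (jumpCells R f (2 ^ L) ∪ (jumpCells R f (2 ^ L)).image (· + 1)) := by
    intro q hq
    obtain ⟨hqr, hcell, hpos, hsup⟩ := Finset.mem_filter.1 hq
    rcases q with - | p
    · exact Finset.mem_insert_self _ _
    refine Finset.mem_insert_of_mem ?_
    by_contra hcon
    simp only [Finset.mem_union, Finset.mem_image, not_or, jumpCells, Finset.mem_filter,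
      Finset.mem_range, not_and, not_not, not_exists] at hcon hqr
    have h1 : R (f (p + 1)) = R (f (p + 1 + 1)) := hcon.1 hqr
    have h2 : R (f p) = R (f (p + 1)) := by
      by_contra hne
      exact hcon.2 p ⟨by omega, hne⟩ rfl
    have h3 := hM.le_iSup (f p)
    -- The right end of an interval is by definition the left end `f` of the next.
    have hb : R (cellRight L e (p + 1)) = R (f p) := by rw [h2, h1]; rfl
    have hcp : (p + 1) * 2 ^ e ≤ 2 ^ L := le_trans (by gcongr; omega) hcell
    rw [hb] at hsup hpos
    rw [linearUtility, hf, coe_cellLeft hcp] at h3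
    rw [coe_cellLeft hcell] at hsup
    push_cast at hsup
    have hw := cellWidth_pos L e
    -- After cancelling `R (f p) > 0`, with `w` the width and `a` the left end of the relevant
    -- interval, this reads `1 - a + w ≤ (1 - a) * (1 + w / 2)`, impossible since `1 - a ≤ 1`.
    have hle := h3.trans hsup
    have hle' : (1 - p * cellWidth L e) * R (f p) ≤
        ((1 - (p + 1) * cellWidth L e) * (1 + cellWidth L e / 2)) * R (f p) := by
      linarith
    have h4 := le_of_mul_le_mul_right hle' hpos
    have h5 : 0 ≤ (p + 1) * cellWidth L e := by positivity
    nlinarith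
  have h1 := hN f hmono (2 ^ L)
  have h2 := Finset.card_le_card hsub
  have h3 := Finset.card_insert_le 0 (jumpCells R f (2 ^ L) ∪ (jumpCells R f (2 ^ L)).image (· + 1))
  have h4 := Finset.card_union_le (jumpCells R f (2 ^ L)) ((jumpCells R f (2 ^ L)).image (· + 1))
  have h5 : ((jumpCells R f (2 ^ L)).image (· + 1)).card ≤ _ := Finset.card_image_le
  omega

theorem IsMonotoneModel.card_relevantContracts_le (hM : IsMonotoneModel r law R) {N : ℕ}
    (hN : ∀ f : ℕ → unitInterval, Monotone f → ∀ Q, (jumpCells R f Q).card + 1 ≤ N) (L : ℕ) :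
    (relevantContracts R L).card ≤ 4 * N * L + 1 := by
  refine (Finset.card_insert_le _ _).trans (Nat.succ_le_succ ?_)
  refine (Finset.card_biUnion_le_card_mul _ _ (4 * N) fun e _ => ?_).trans_eq
    (by rw [Finset.card_range]; ring)
  refine (Finset.card_union_le _ _).trans ?_
  have h1 := hM.card_relevantCells_le hN L (e + 1)
  have h2 : ((relevantCells R L (e + 1)).image (fun q => cellRight L e (2 * q))).card ≤ _ :=
    Finset.card_image_le
  have h3 : ((relevantCells R L (e + 1)).image (fun q => cellRight L e (2 * q + 1))).card ≤ _ :=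
    Finset.card_image_le
  omega

end Round

/-! ### Regret over all rounds -/

section Regret

variable {m : ℕ} {r : Fin m → ℝ} {law : unitInterval → Fin m → ℝ} {R : unitInterval → ℝ}

/-- Telescoping: the regret of a round is charged to the growth of `Φ`, whatever the reward turns
out to be, and the rounds where this fails are charged to `bad`. -/
theorem regretOf_le_of_potential (hM : IsMonotoneModel r law R) (π : Policy)
    (Φ bad : History → ℝ) (hΦ : Φ [] = 0)
    (hstep : ∀ h x, (⨆ ρ, linearUtility R ρ) - linearUtility R (π h) ≤
      Φ (h ++ [(π h, x)]) - Φ h + bad h) (T : ℕ) :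
    regretOf r law (linearUtility R) π T ≤ historyExpectation r law π T Φ +
      ∑ t ∈ Finset.range T, historyExpectation r law π t bad := by
  rw [regretOf]
  induction T with
  | zero => simp [historyExpectation, hΦ]
  | succ T ih =>
    rw [Finset.sum_range_succ]
    set s := ⨆ ρ, linearUtility R ρ
    have key : historyExpectation r law π T (fun h => s + Φ h) ≤
        historyExpectation r law π T (fun h => (linearUtility R (π h) +
          ∑ j, law (π h) j * Φ (h ++ [(π h, r j)])) + bad h) := by
      refine historyExpectation_mono hM.law_nonneg hM.reward_mem fun h _ => ?_
      have h1 : ∑ j, law (π h) j * (s - linearUtility R (π h) + Φ h - bad h) ≤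
          ∑ j, law (π h) j * Φ (h ++ [(π h, r j)]) :=
        Finset.sum_le_sum fun j _ => mul_le_mul_of_nonneg_left
          (by linarith [hstep h (r j)]) (hM.law_nonneg _ _)
      rw [← Finset.sum_mul, hM.law_sum, one_mul] at h1
      linarith
    rw [historyExpectation_add, historyExpectation_add, historyExpectation_add,
      historyExpectation_const hM.law_sum] at key
    have hsum : historyExpectation r law π (T + 1)
        (fun h => (h.map (fun o => linearUtility R o.1)).sum) =
        historyExpectation r law π T (fun h => (h.map (fun o => linearUtility R o.1)).sum) +
          historyExpectation r law π T (fun h => linearUtility R (π h)) := by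
      rw [historyExpectation, ← historyExpectation_add]
      simp [← Finset.sum_mul, hM.law_sum]
    have hlast : historyExpectation r law π (T + 1) Φ = historyExpectation r law π T
        (fun h => ∑ j, law (π h) j * Φ (h ++ [(π h, r j)])) := rfl
    rw [hsum, hlast]
    push_cast
    linarith

/-- Bound on the regret accumulated while the estimates are accurate. -/
noncomputable def zoomingPotential (R : unitInterval → ℝ) (L : ℕ) (K : ℝ) (h : History) : ℝ :=
  16 * √K * ∑ b ∈ relevantContracts R L, √(plays h b : ℝ) + h.length * (1 / 2 ^ L)

theorem zoomingPotential_mono {L : ℕ} {K : ℝ} (h : History) (o : unitInterval × ℝ) :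
    zoomingPotential R L K h ≤ zoomingPotential R L K (h ++ [o]) := by
  unfold zoomingPotential
  gcongr with b
  · obtain ⟨ρ, x⟩ := o
    rw [plays_snoc]
    omega
  · simp

theorem zoomingPotential_snoc_ge {L : ℕ} {K : ℝ} (hK : 0 ≤ K) (h : History) {b : unitInterval}
    (hb : b ∈ relevantContracts R L) (x : ℝ) :
    8 * radius K (plays h b) + 1 / 2 ^ L ≤
      zoomingPotential R L K (h ++ [(b, x)]) - zoomingPotential R L K h := by
  classical
  have hsum : ∑ c ∈ relevantContracts R L, √(plays (h ++ [(b, x)]) c : ℝ) -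
      ∑ c ∈ relevantContracts R L, √(plays h c : ℝ) =
      √((plays h b + 1 : ℕ) : ℝ) - √(plays h b : ℝ) := by
    rw [← Finset.sum_sub_distrib, Finset.sum_eq_single_of_mem b hb]
    · simp [plays_snoc]
    · intro c _ hc
      simp [plays_snoc, hc.symm]
  have hrad := radius_le_sqrt_sub_sqrt hK (plays h b)
  rw [← hsum] at hrad
  simp only [zoomingPotential, List.length_append, List.length_singleton]
  push_cast
  nlinarith

/-- Cauchy-Schwarz over the relevant contracts, whose play counts add up to at most `T`; the
discretization costs `T / 2 ^ L ≤ 1`. -/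
theorem zoomingPotential_le {L T : ℕ} {K : ℝ} (hT : T ≤ 2 ^ L) {h : History}
    (hh : IsUnitHistory T h) {B : ℝ} (hB : ((relevantContracts R L).card : ℝ) ≤ B) :
    zoomingPotential R L K h ≤ 16 * √K * √(B * T) + 1 := by
  unfold zoomingPotential
  gcongr
  · refine Real.le_sqrt_of_sq_le (sq_sum_le_card_mul_sum_sq.trans ?_)
    have h1 : ∑ b ∈ relevantContracts R L, √(plays h b : ℝ) ^ 2 ≤ T := by
      simp only [Real.sq_sqrt (Nat.cast_nonneg _)]
      exact_mod_cast (sum_plays_le_length _ h).trans_eq hh.1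
    have h0 : (0 : ℝ) ≤ (relevantContracts R L).card := Nat.cast_nonneg _
    gcongr
    linarith
  · rw [hh.1, mul_one_div, div_le_one (by positivity)]
    exact_mod_cast hT

theorem IsMonotoneModel.regretOf_zoomingPolicy_le (hM : IsMonotoneModel r law R) {N : ℕ}
    (hN : ∀ f : ℕ → unitInterval, Monotone f → ∀ Q, (jumpCells R f Q).card + 1 ≤ N)
    {L T : ℕ} (hT : T ≤ 2 ^ L) {K : ℝ} (hK : 1 ≤ K) :
    regretOf r law (linearUtility R) (zoomingPolicy L K) T ≤
      16 * √K * √((4 * N * L + 1) * T) + 1 +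
        T * ((2 ^ L + 1) * T * (2 * Real.exp (-(K / 8)))) := by
  classical
  refine (regretOf_le_of_potential hM _ (zoomingPotential R L K)
    (fun h => if IsAccurate R K (dyadicGrid L) h then 0 else 1) ?_ ?_ T).trans ?_
  · simp [zoomingPotential, plays]
  · intro h x
    have hs := (exists_isSelected L K h).choose_spec
    split_ifs with hacc
    · rw [add_zero]
      exact (hs.regret_le hM (by linarith) hacc).trans (zoomingPotential_snoc_ge (by linarith) h
        (hs.mem_relevantContracts hM (by linarith) hacc) x)
    · have h1 := hM.iSup_le_one
      have h2 := (hM.linearUtility_mem (zoomingPolicy L K h)).1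
      have h3 := zoomingPotential_mono (R := R) (L := L) (K := K) h (zoomingPolicy L K h, x)
      linarith
  · refine add_le_add ?_ ?_
    · have hcard : ((relevantContracts R L).card : ℝ) ≤ 4 * N * L + 1 := by
        exact_mod_cast hM.card_relevantContracts_le hN L
      exact (historyExpectation_mono hM.law_nonneg hM.reward_mem
        fun h hh => zoomingPotential_le hT hh hcard).trans_eq
          (historyExpectation_const hM.law_sum T _)
    · calc _ ≤ ∑ _t ∈ Finset.range T, (2 ^ L + 1) * T * (2 * Real.exp (-(K / 8))) := by
            refine Finset.sum_le_sum fun t ht => ?_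
            refine (hM.historyExpectation_inaccurate_le _ hK _ (Finset.mem_range.1 ht).le).trans ?_
            have : ((dyadicGrid L).card : ℝ) ≤ 2 ^ L + 1 := by
              exact_mod_cast card_dyadicGrid_le L
            gcongr
        _ = _ := by simp

/-- The learning algorithm for `T` rounds. -/
noncomputable def zoomingAlgorithm (T : ℕ) : Policy :=
  zoomingPolicy (Nat.log 2 T + 1) (24 * Real.log (T + 1))

theorem IsMonotoneModel.regretOf_zoomingAlgorithm_le (hM : IsMonotoneModel r law R) {N : ℕ}
    (hN : ∀ f : ℕ → unitInterval, Monotone f → ∀ Q, (jumpCells R f Q).card + 1 ≤ N)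
    {T : ℕ} (hT : 1 ≤ T) :
    regretOf r law (linearUtility R) (zoomingAlgorithm T) T ≤
      330 * √((N : ℝ) * T) * Real.log (T + 1) ^ 1 := by
  set l := Real.log ((T : ℝ) + 1) with hl
  set L := Nat.log 2 T + 1 with hL
  have hT1 : (1 : ℝ) ≤ T := by exact_mod_cast hT
  have hN1 : (1 : ℝ) ≤ N := by
    have := hN (fun _ => 0) monotone_const 0
    exact_mod_cast (by omega : 1 ≤ N)
  have hlog2 := Real.log_two_gt_d9
  have hl2 : 0.69 ≤ l :=
    (by linarith : (0.69 : ℝ) ≤ Real.log 2).trans (Real.log_le_log (by norm_num) (by linarith))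
  have hTL : T ≤ 2 ^ L := (Nat.lt_pow_succ_log_self one_lt_two T).le
  have hLT : (2 : ℝ) ^ L ≤ 2 * T := by
    have : 2 ^ L ≤ 2 * T := by
      rw [hL, pow_succ, mul_comm]
      exact Nat.mul_le_mul_left _ (Nat.pow_log_le_self 2 (by omega))
    exact_mod_cast this
  have hLl : (L : ℝ) ≤ 3 * l := by
    have h1 : (Nat.log 2 T : ℝ) * Real.log 2 ≤ l := by
      rw [← Real.log_pow]
      refine Real.log_le_log (by positivity) ?_
      have : (2 : ℝ) ^ Nat.log 2 T ≤ T := by exact_mod_cast Nat.pow_log_le_self 2 (by omega)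
      linarith
    have h2 : (0 : ℝ) ≤ Nat.log 2 T := Nat.cast_nonneg _
    rw [hL]
    push_cast
    nlinarith
  refine (hM.regretOf_zoomingPolicy_le hN hTL (by linarith : 1 ≤ 24 * l)).trans ?_
  -- `24 = 8 * 3` gives the failure factor `(T + 1) ^ (-3)`, which absorbs the union over rounds,
  -- counts and the at most `2 * T + 1` grid points.
  have hexp : Real.exp (-(24 * l / 8)) = ((T : ℝ) + 1)⁻¹ ^ 3 := by
    rw [show -(24 * l / 8) = (3 : ℕ) * -l by push_cast; ring, Real.exp_nat_mul, Real.exp_neg, hl,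
      Real.exp_log (by linarith)]
  have hfail : T * ((2 ^ L + 1) * T * (2 * Real.exp (-(24 * l / 8)))) ≤ 4 := by
    rw [hexp, inv_pow]
    calc _ ≤ (T : ℝ) * ((2 * T + 1) * T * (2 * (((T : ℝ) + 1) ^ 3)⁻¹)) := by gcongr
      _ = ((T : ℝ) * (2 * T + 1) * T * 2) / ((T : ℝ) + 1) ^ 3 := by ring
      _ ≤ 4 := by
        rw [div_le_iff₀ (by positivity)]
        nlinarith [pow_pos (by linarith : (0 : ℝ) < T) 2]
  have hNT : 1 ≤ √((N : ℝ) * T) := Real.one_le_sqrt.2 (by nlinarith)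
  -- `24 * 15 = 360 ≤ 19 ^ 2`. The leading term is then `16 * 19 = 304`, and the remaining `26`
  -- cover the additive `1 + 4` because `l ≥ 0.69`.
  have hmain : √(24 * l) * √((4 * N * L + 1) * T) ≤ 19 * l * √((N : ℝ) * T) := by
    rw [← Real.sqrt_mul (by linarith)]
    refine Real.sqrt_le_iff.2 ⟨by positivity, ?_⟩
    rw [mul_pow, Real.sq_sqrt (by positivity)]
    have h1 : 4 * N * L + 1 ≤ 15 * N * l := by nlinarith
    calc _ ≤ 24 * l * ((15 * N * l) * T) := by gcongr
      _ ≤ _ := by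
        nlinarith [(by positivity : 0 ≤ (N : ℝ) * T * l ^ 2)]
  have hlN : 0.69 ≤ l * √((N : ℝ) * T) := by nlinarith
  linarith

end Regret

/-! ### Principal-agent problems -/

-- The actions reached just after a jump are distinct, their values strictly increasing, and none of
-- them is `g 0`.
open Classical in
theorem card_filter_ne_succ_lt {n : ℕ} [NeZero n] (v : Fin n → ℝ) (g : ℕ → Fin n)
    (hg : Monotone (v ∘ g)) (Q : ℕ) :
    ((Finset.range Q).filter fun q => v (g q) ≠ v (g (q + 1))).card + 1 ≤ n := by
  set S := (Finset.range Q).filter fun q => v (g q) ≠ v (g (q + 1)) with hS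
  have hlt : ∀ q ∈ S, v (g q) < v (g (q + 1)) := fun q hq =>
    lt_of_le_of_ne (hg q.le_succ) (Finset.mem_filter.1 hq).2
  have hinj : Set.InjOn (fun q => g (q + 1)) S := by
    have aux : ∀ p q, p < q → q ∈ S → g (p + 1) ≠ g (q + 1) := by
      intro p q hpq hq heq
      have h1 : v (g (p + 1)) ≤ v (g q) := hg hpq
      rw [heq] at h1
      exact absurd (hlt q hq) (not_lt.2 h1)
    intro p hp q hq heq
    rcases lt_trichotomy p q with hpq | hpq | hpq
    · exact absurd heq (aux p q hpq hq)
    · exact hpq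
    · exact absurd heq.symm (aux q p hpq hp)
  have hsub : S.image (fun q => g (q + 1)) ⊆ Finset.univ.erase (g 0) := by
    intro i hi
    obtain ⟨q, hq, rfl⟩ := Finset.mem_image.1 hi
    refine Finset.mem_erase.2 ⟨fun heq => ?_, Finset.mem_univ _⟩
    have h1 := hlt q hq
    rw [heq] at h1
    exact absurd (hg q.zero_le) (not_le.2 h1)
  have hcard := Finset.card_le_card hsub
  rw [Finset.card_image_of_injOn hinj, Finset.card_erase_of_mem (Finset.mem_univ _),
    Finset.card_univ, Fintype.card_fin] at hcard
  have := NeZero.pos n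
  omega

namespace PrincipalAgent

variable {n m : ℕ} [NeZero n] {P : PrincipalAgent n m} {br : unitInterval → Fin n}

/-- Adding the optimality inequalities at `ρ` and at `σ` cancels the costs and leaves `(σ - ρ) * (R
σ - R ρ) ≥ 0`. -/
theorem IsBestResponse.monotone_expectedReward (hbr : P.IsBestResponse br) :
    Monotone fun ρ => P.expectedReward (br ρ) := by
  intro ρ σ hρσ
  rcases hρσ.eq_or_lt with rfl | hlt
  · exact le_rfl
  have h1 := (hbr ρ).1 (br σ)
  have h2 := (hbr σ).1 (br ρ)
  have h3 : (ρ : ℝ) < σ := hlt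
  unfold agentUtility at h1 h2
  by_contra hcon
  simp only [not_le] at hcon
  nlinarith

theorem IsBestResponse.card_jumpCells_lt (hbr : P.IsBestResponse br) {f : ℕ → unitInterval}
    (hf : Monotone f) (Q : ℕ) :
    (jumpCells (fun ρ => P.expectedReward (br ρ)) f Q).card + 1 ≤ n :=
  card_filter_ne_succ_lt P.expectedReward (br ∘ f) (hbr.monotone_expectedReward.comp hf) Q

theorem IsBestResponse.isMonotoneModel (hbr : P.IsBestResponse br) :
    IsMonotoneModel P.reward (fun ρ => P.outcomeProb (br ρ))
      (fun ρ => P.expectedReward (br ρ)) where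
  reward_mem := P.reward_mem
  law_nonneg _ _ := P.outcomeProb_nonneg _ _
  law_sum _ := P.outcomeProb_sum _
  mean_eq _ := rfl
  mono := hbr.monotone_expectedReward

theorem IsBestResponse.regret_zoomingAlgorithm_le (hbr : P.IsBestResponse br) {T : ℕ}
    (hT : 1 ≤ T) :
    P.regret br (zoomingAlgorithm T) T ≤ 330 * √((n : ℝ) * T) * Real.log (T + 1) ^ 1 :=
  hbr.isMonotoneModel.regretOf_zoomingAlgorithm_le (fun _ hf Q => hbr.card_jumpCells_lt hf Q) hT

end PrincipalAgent

/-! ### Bayesian problems, by averaging over types -/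

namespace BayesianPrincipalAgent

variable {n m d : ℕ} [NeZero n] {P : BayesianPrincipalAgent n m d}
  {br : Fin d → unitInterval → Fin n}

/-- Principal's expected reward under the linear contract `ρ`, in expectation over the type. -/
def meanReward (P : BayesianPrincipalAgent n m d) (br : Fin d → unitInterval → Fin n)
    (ρ : unitInterval) : ℝ :=
  ∑ k, P.typeProb k * (P.ofType k).expectedReward (br k ρ)

theorem utility_eq : P.utility br = linearUtility (P.meanReward br) := by
  funext ρ
  rw [utility, linearUtility, meanReward, Finset.mul_sum]
  refine Finset.sum_congr rfl fun k _ => ?_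
  rw [PrincipalAgent.utility, PrincipalAgent.principalUtility]
  ring

theorem IsBestResponse.isMonotoneModel (hbr : P.IsBestResponse br) :
    IsMonotoneModel P.reward (P.outcomeLaw br) (P.meanReward br) where
  reward_mem := P.reward_mem
  law_nonneg _ _ := Finset.sum_nonneg fun k _ =>
    mul_nonneg (P.typeProb_nonneg k) (P.outcomeProb_nonneg _ _ _)
  law_sum ρ := by
    simp only [outcomeLaw]
    rw [Finset.sum_comm]
    simp only [← Finset.mul_sum, P.outcomeProb_sum, mul_one, P.typeProb_sum]
  mean_eq ρ := by
    simp only [outcomeLaw, Finset.sum_mul, meanReward, PrincipalAgent.expectedReward,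
      Finset.mul_sum]
    rw [Finset.sum_comm]
    exact Finset.sum_congr rfl fun k _ => Finset.sum_congr rfl fun j _ => mul_assoc _ _ _
  mono _ _ hρσ := Finset.sum_le_sum fun k _ =>
    mul_le_mul_of_nonneg_left ((hbr k).monotone_expectedReward hρσ) (P.typeProb_nonneg k)

/-- A jump of the average is a jump for some type, which gives at most `(n - 1) * d` jumps. The
extra `1` fits because `d ≥ 1`: the type probabilities sum to `1`. -/
theorem IsBestResponse.card_jumpCells_lt (hbr : P.IsBestResponse br) {f : ℕ → unitInterval}
    (hf : Monotone f) (Q : ℕ) : (jumpCells (P.meanReward br) f Q).card + 1 ≤ n * d := by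
  classical
  have hsub : jumpCells (P.meanReward br) f Q ⊆ Finset.univ.biUnion fun k =>
      jumpCells (fun ρ => (P.ofType k).expectedReward (br k ρ)) f Q := by
    intro q hq
    obtain ⟨hq1, hq2⟩ := Finset.mem_filter.1 hq
    by_contra hcon
    simp only [Finset.mem_biUnion, Finset.mem_univ, true_and, jumpCells, Finset.mem_filter, hq1,
      not_exists, not_not] at hcon
    exact hq2 (Finset.sum_congr rfl fun k _ => by rw [hcon k])
  have hd : d ≠ 0 := by
    rintro rfl
    simpa using P.typeProb_sum
  have h1 := (Finset.card_le_card hsub).trans (Finset.card_biUnion_le_card_mul _ _ (n - 1)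
    fun k _ => by have := (hbr k).card_jumpCells_lt hf Q; omega)
  rw [Finset.card_univ, Fintype.card_fin] at h1
  obtain ⟨n', rfl⟩ := Nat.exists_eq_succ_of_ne_zero (NeZero.ne n)
  obtain ⟨d', rfl⟩ := Nat.exists_eq_succ_of_ne_zero hd
  simp only [Nat.succ_eq_add_one, Nat.add_sub_cancel] at h1 ⊢
  nlinarith

theorem IsBestResponse.regret_zoomingAlgorithm_le (hbr : P.IsBestResponse br) {T : ℕ}
    (hT : 1 ≤ T) :
    P.regret br (zoomingAlgorithm T) T ≤
      330 * √((n : ℝ) * d * T) * Real.log (T + 1) ^ 1 := by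
  have := hbr.isMonotoneModel.regretOf_zoomingAlgorithm_le
    (fun _ hf Q => hbr.card_jumpCells_lt hf Q) hT
  rwa [Nat.cast_mul, ← utility_eq] at this

end BayesianPrincipalAgent

theorem mainTheorem4 :
    (∃ alg : ℕ → Policy, ∃ C : ℝ, ∃ a : ℕ,
      ∀ T : ℕ, 1 ≤ T → ∀ (n m : ℕ) [NeZero n] (P : PrincipalAgent n m)
        (br : unitInterval → Fin n), P.IsBestResponse br →
          P.regret br (alg T) T
            ≤ C * Real.sqrt ((n : ℝ) * (T : ℝ)) * Real.log ((T : ℝ) + 1) ^ a) ∧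
    (∃ alg : ℕ → Policy, ∃ C : ℝ, ∃ a : ℕ,
      ∀ T : ℕ, 1 ≤ T → ∀ (n m d : ℕ) [NeZero n] (P : BayesianPrincipalAgent n m d)
        (br : Fin d → unitInterval → Fin n), P.IsBestResponse br →
          P.regret br (alg T) T
            ≤ C * Real.sqrt ((n : ℝ) * (d : ℝ) * (T : ℝ)) * Real.log ((T : ℝ) + 1) ^ a) :=
  ⟨⟨zoomingAlgorithm, 330, 1, fun _ hT _ _ _ _ _ hbr => hbr.regret_zoomingAlgorithm_le hT⟩,
    ⟨zoomingAlgorithm, 330, 1, fun _ hT _ _ _ _ _ _ hbr => hbr.regret_zoomingAlgorithm_le hT⟩⟩
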